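/- Throughout, compact groups are Hausdorff and carry their normalized Haar measure $dx$ (total mass $1$), and $\widehat f(\gamma)=\int_G f(x)\overline{\gamma(x)}\,dx$ for $f\in L^1(G)$ and a continuous character $\gamma\in\widehat G$. A function $m:\widehat G\to\mathbb C$ on the dual of a compact abelian group $G$ is called a Sidon weight on $G$ if there is a constant $S_m>0$ such that $$\sum_{\gamma\in\operatorname{supp}(m)}|m(\gamma)\widehat f(\gamma)|\le S_m\|f\|_{L^\infty(G)}$$ for every trigonometric polynomial $f$ on $G$ (finite linear combination of characters) whose Fourier transform is supported in $\operatorname{supp}(m)=\{\gamma : m(\gamma)\neq 0\}$. For $r\ge 0$ let $L\log^rL(G)$ be the space of all $f\in L^1(G)$ with $\int_G|f|\log^r(1+|f|)\,dx<\infty$. For a subspace $X$ of $L^1(G)$, a function $m\in\ell^\infty(\widehat G)$ is called a multiplier from $X$ to $L^2(G)$ if $\sum_{\gamma\in\widehat G}|m(\gamma)\widehat f(\gamma)|^2<\infty$ for every $f\in X$. **Proposition.** Let $G_1,\dots,G_n$ be compact abelian groups and, for $j=1,\dots,n$, let $m_j:\widehat{G_j}\to\mathbb C$ be a Sidon weight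 on $G_j$. Set $G=G_1\times\cdots\times G_n$ and $m=m_1\otimes\cdots\otimes m_n$, that is, $m(\gamma_1,\dots,\gamma_n)=m_1(\gamma_1)\cdots m_n(\gamma_n)$ on $\widehat G=\widehat{G_1}\times\cdots\times\widehat{G_n}$. Then there are positive constants $A_{m,n}$ and $B_{m,n}$, depending only on $m$ and $n$, such that for every $f\in L^1(G)$ $$\Big(\sum_{\gamma\in\widehat G}|m(\gamma)\widehat f(\gamma)|^2\Big)^{1/2}\le A_{m,n}\int_G|f(x)|\log^{n/2}(1+|f(x)|)\,dx+B_{m,n}$$ (where the right-hand side may be $+\infty$). In particular, $m$ is a multiplier from $L\log^{n/2}L(G)$ to $L^2(G)$. -/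

import Mathlib

open MeasureTheory
open scoped ENNReal NNReal

namespace SidonWeight

noncomputable section

/-- The Haar measure of a compact group `G`, on its Borel sets, normalized to have mass `1`. The
Borel `σ`-algebra is written out, so that for a product `∏ j, G j` it is the Borel `σ`-algebra of
the product and not the (possibly smaller) product of the Borel `σ`-algebras. -/
def haarProb (G : Type*) [CommGroup G] [TopologicalSpace G] [IsTopologicalGroup G]
    [CompactSpace G] : @Measure G (borel G) :=
  letI : MeasurableSpace G := borel G
  haveI : BorelSpace G := ⟨rfl⟩
  Measure.haarMeasure (⊤ : TopologicalSpace.PositiveCompacts G)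

theorem haarProb_univ (G : Type*) [CommGroup G] [TopologicalSpace G] [IsTopologicalGroup G]
    [CompactSpace G] : haarProb G Set.univ = 1 := by
  let : MeasurableSpace G := borel G
  have : BorelSpace G := ⟨rfl⟩
  exact Measure.haarMeasure_self (K₀ := (⊤ : TopologicalSpace.PositiveCompacts G))

/-- The function `x ↦ γ x`, for a character `γ`, with values in `ℂ`. -/
def character {G : Type*} [CommGroup G] [TopologicalSpace G] (γ : PontryaginDual G) : G → ℂ :=
  fun x => (γ x : ℂ)

/-- The Fourier coefficient `f̂(γ) = ∫ f(x) conj(γ(x)) dx`. -/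
def fourierTransform {G : Type*} [CommGroup G] [TopologicalSpace G] [IsTopologicalGroup G]
    [CompactSpace G] (f : G → ℂ) (γ : PontryaginDual G) : ℂ :=
  ∫ x, f x * (starRingEnd ℂ) (character γ x) ∂(haarProb G)

/-- Trigonometric polynomials: finite linear combinations of characters. -/
def IsTrigPolynomial {G : Type*} [CommGroup G] [TopologicalSpace G] (f : G → ℂ) : Prop :=
  f ∈ Submodule.span ℂ (Set.range (character (G := G)))

/-- `m` is a Sidon weight on `G`: there is `S > 0` with
`∑_{γ ∈ supp m} |m(γ) f̂(γ)| ≤ S ‖f‖_∞` for each trigonometric polynomial `f` whose Fourier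
transform is supported in `supp m`. -/
def IsSidonWeight {G : Type*} [CommGroup G] [TopologicalSpace G] [IsTopologicalGroup G]
    [CompactSpace G] (m : PontryaginDual G → ℂ) : Prop :=
  ∃ S : ℝ, 0 < S ∧ ∀ f : G → ℂ, IsTrigPolynomial f →
    Function.support (fourierTransform f) ⊆ Function.support m →
    ∑' γ : Function.support m, ‖m γ * fourierTransform f γ‖ₑ
      ≤ ENNReal.ofReal S * eLpNorm f ∞ (haarProb G)

/-- The integral `∫ |f| log^r(1 + |f|)`, as an extended nonnegative real. -/
def logIntegral {G : Type*} [CommGroup G] [TopologicalSpace G] [IsTopologicalGroup G]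
    [CompactSpace G] (r : ℝ≥0) (f : G → ℂ) : ℝ≥0∞ :=
  ∫⁻ x, ENNReal.ofReal (‖f x‖ * Real.log (1 + ‖f x‖) ^ (r : ℝ)) ∂(haarProb G)

theorem log_bound_add (r : ℝ≥0) (a b : ℂ) :
    ‖a + b‖ * Real.log (1 + ‖a + b‖) ^ (r : ℝ) ≤
      2 * 2 ^ (r : ℝ) * (‖a‖ * Real.log (1 + ‖a‖) ^ (r : ℝ)) +
      2 * 2 ^ (r : ℝ) * (‖b‖ * Real.log (1 + ‖b‖) ^ (r : ℝ)) := by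
  have key : ∀ s t : ℝ, 0 ≤ s → 0 ≤ t → s ≤ 2 * t →
      s * Real.log (1 + s) ^ (r : ℝ) ≤ 2 * 2 ^ (r : ℝ) * (t * Real.log (1 + t) ^ (r : ℝ)) := by
    intro s t hs ht hst
    have h1 : Real.log (1 + s) ≤ 2 * Real.log (1 + t) := by
      have h2 : 2 * Real.log (1 + t) = Real.log ((1 + t) ^ 2) := by
        rw [Real.log_pow]; norm_num
      rw [h2]
      exact Real.log_le_log (by linarith) (by nlinarith)
    have h0 : 0 ≤ Real.log (1 + s) := Real.log_nonneg (by linarith)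
    have h0t : 0 ≤ Real.log (1 + t) := Real.log_nonneg (by linarith)
    calc s * Real.log (1 + s) ^ (r : ℝ)
        ≤ (2 * t) * (2 * Real.log (1 + t)) ^ (r : ℝ) := by gcongr
      _ = _ := by rw [Real.mul_rpow (by norm_num) h0t]; ring
  have pos : ∀ c : ℂ, 0 ≤ 2 * 2 ^ (r : ℝ) * (‖c‖ * Real.log (1 + ‖c‖) ^ (r : ℝ)) := by
    intro c
    have h0 : 0 ≤ Real.log (1 + ‖c‖) := Real.log_nonneg (by linarith [norm_nonneg c])
    positivity
  have hab := norm_add_le a b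
  rcases le_total ‖a‖ ‖b‖ with h | h
  · have := key ‖a + b‖ ‖b‖ (norm_nonneg _) (norm_nonneg _) (by linarith)
    linarith [pos a]
  · have := key ‖a + b‖ ‖a‖ (norm_nonneg _) (norm_nonneg _) (by linarith)
    linarith [pos b]

theorem log_bound_mul (r : ℝ≥0) (k : ℕ) (c a : ℂ) (hc : ‖c‖ ≤ k) :
    ‖c * a‖ * Real.log (1 + ‖c * a‖) ^ (r : ℝ) ≤
      k * k ^ (r : ℝ) * (‖a‖ * Real.log (1 + ‖a‖) ^ (r : ℝ)) := by
  have h0a : 0 ≤ Real.log (1 + ‖a‖) := Real.log_nonneg (by linarith [norm_nonneg a])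
  have h0 : 0 ≤ Real.log (1 + ‖c * a‖) := Real.log_nonneg (by linarith [norm_nonneg (c * a)])
  have hn : ‖c * a‖ ≤ k * ‖a‖ := by rw [norm_mul]; gcongr
  have h1 : Real.log (1 + ‖c * a‖) ≤ k * Real.log (1 + ‖a‖) := by
    rw [← Real.log_pow]
    refine Real.log_le_log (by positivity) ?_
    have := one_add_mul_le_pow (a := ‖a‖) (by linarith [norm_nonneg a]) k
    linarith
  calc ‖c * a‖ * Real.log (1 + ‖c * a‖) ^ (r : ℝ)
      ≤ (k * ‖a‖) * (k * Real.log (1 + ‖a‖)) ^ (r : ℝ) := by gcongr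
    _ = _ := by rw [Real.mul_rpow (by positivity) h0a]; ring

/-- The space `L log^r L (G)` of (classes of) integrable functions `f` on `G` with
`∫ |f| log^r(1 + |f|) < ∞`, a subspace of `L¹(G)`. -/
def LLog (G : Type*) [CommGroup G] [TopologicalSpace G] [IsTopologicalGroup G]
    [CompactSpace G] (r : ℝ≥0) : Submodule ℂ (Lp ℂ 1 (haarProb G)) where
  carrier := {f | logIntegral r (f : G → ℂ) < ∞}
  zero_mem' := by
    have h : logIntegral r ((0 : Lp ℂ 1 (haarProb G)) : G → ℂ) = 0 := by
      unfold logIntegral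
      rw [lintegral_congr_ae (g := fun _ => 0)]
      · simp
      · filter_upwards [Lp.coeFn_zero ℂ 1 (haarProb G)] with x hx
        rw [hx]
        simp
    change logIntegral r ((0 : Lp ℂ 1 (haarProb G)) : G → ℂ) < ∞
    rw [h]
    exact ENNReal.zero_lt_top
  add_mem' := by
    intro f g hf hg
    change logIntegral r f < ∞ at hf
    change logIntegral r g < ∞ at hg
    change logIntegral r (f + g : Lp ℂ 1 (haarProb G)) < ∞
    unfold logIntegral at hf hg ⊢
    set C : ℝ≥0∞ := ENNReal.ofReal (2 * 2 ^ (r : ℝ))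
    set F : G → ℝ≥0∞ := fun x => ENNReal.ofReal (‖f x‖ * Real.log (1 + ‖f x‖) ^ (r : ℝ))
    set H : G → ℝ≥0∞ := fun x => ENNReal.ofReal (‖g x‖ * Real.log (1 + ‖g x‖) ^ (r : ℝ))
    have hCt : C ≠ ∞ := ENNReal.ofReal_ne_top
    have hF : AEMeasurable F (haarProb G) := by
      have := (Lp.aestronglyMeasurable f).norm.aemeasurable
      exact (this.mul ((Real.measurable_log.comp_aemeasurable
        (this.const_add 1)).pow_const (r : ℝ))).ennreal_ofReal
    calc _ ≤ ∫⁻ x, C * F x + C * H x ∂(haarProb G) := by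
          refine lintegral_mono_ae ?_
          filter_upwards [Lp.coeFn_add f g] with x hx
          rw [hx, Pi.add_apply]
          refine (ENNReal.ofReal_le_ofReal (log_bound_add r (f x) (g x))).trans ?_
          refine ENNReal.ofReal_add_le.trans ?_
          rw [ENNReal.ofReal_mul (p := 2 * 2 ^ (r : ℝ)) (by positivity),
            ENNReal.ofReal_mul (p := 2 * 2 ^ (r : ℝ)) (by positivity)]
      _ = C * ∫⁻ x, F x ∂(haarProb G) + C * ∫⁻ x, H x ∂(haarProb G) := by
          rw [lintegral_add_left' (hF.const_mul C), lintegral_const_mul' _ _ hCt,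
            lintegral_const_mul' _ _ hCt]
      _ < ∞ := ENNReal.add_lt_top.2
          ⟨ENNReal.mul_lt_top hCt.lt_top hf, ENNReal.mul_lt_top hCt.lt_top hg⟩
  smul_mem' := by
    intro c f hf
    change logIntegral r f < ∞ at hf
    change logIntegral r (c • f : Lp ℂ 1 (haarProb G)) < ∞
    unfold logIntegral at hf ⊢
    obtain ⟨k, hk⟩ := exists_nat_ge ‖c‖
    set C : ℝ≥0∞ := ENNReal.ofReal (k * k ^ (r : ℝ))
    have hCt : C ≠ ∞ := ENNReal.ofReal_ne_top
    set F : G → ℝ≥0∞ := fun x => ENNReal.ofReal (‖f x‖ * Real.log (1 + ‖f x‖) ^ (r : ℝ))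
    calc _ ≤ ∫⁻ x, C * F x ∂(haarProb G) := by
          refine lintegral_mono_ae ?_
          filter_upwards [Lp.coeFn_smul c f] with x hx
          rw [hx, Pi.smul_apply, smul_eq_mul]
          refine (ENNReal.ofReal_le_ofReal (log_bound_mul r k c (f x) hk)).trans ?_
          rw [ENNReal.ofReal_mul (by positivity)]
      _ = C * ∫⁻ x, F x ∂(haarProb G) := lintegral_const_mul' _ _ hCt
      _ < ∞ := ENNReal.mul_lt_top hCt.lt_top hf

/-- `m` is a multiplier from the subspace `X` of `L¹(G)` to `L²(G)`: it is bounded and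
`∑_γ |m(γ) f̂(γ)|² < ∞` for every `f ∈ X`. -/
def IsMultiplierToL2 {G : Type*} [CommGroup G] [TopologicalSpace G] [IsTopologicalGroup G]
    [CompactSpace G] (X : Submodule ℂ (Lp ℂ 1 (haarProb G))) (m : PontryaginDual G → ℂ) : Prop :=
  Memℓp m ∞ ∧ ∀ f ∈ X, Summable fun γ => ‖m γ * fourierTransform (f : G → ℂ) γ‖ ^ 2

/-- The `j`-th component of a character `γ` of `∏ i, G i`: its restriction to the `j`-th factor.
Thus `γ x = ∏ j, (component γ j) (x j)`, which identifies the dual of the product with the product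
of the duals. -/
def component {ι : Type*} [DecidableEq ι] {G : ι → Type*} [∀ j, CommGroup (G j)]
    [∀ j, TopologicalSpace (G j)] (γ : PontryaginDual (∀ j, G j)) (j : ι) :
    PontryaginDual (G j) :=
  PontryaginDual.map ⟨MonoidHom.mulSingle G j, continuous_mulSingle j⟩ γ

theorem apply_eq_prod_component {ι : Type*} [DecidableEq ι] [Fintype ι] {G : ι → Type*}
    [∀ j, CommGroup (G j)] [∀ j, TopologicalSpace (G j)] (γ : PontryaginDual (∀ j, G j))
    (x : ∀ j, G j) : γ x = ∏ j, component γ j (x j) := by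
  conv_lhs => rw [← Finset.univ_prod_mulSingle x, map_prod]
  rfl

/-- The tensor product `(m₁ ⊗ ⋯ ⊗ mₙ)(γ₁, …, γₙ) = m₁(γ₁) ⋯ mₙ(γₙ)`. -/
def tensorWeight {ι : Type*} [DecidableEq ι] [Fintype ι] {G : ι → Type*} [∀ j, CommGroup (G j)]
    [∀ j, TopologicalSpace (G j)] (m : ∀ j, PontryaginDual (G j) → ℂ) :
    PontryaginDual (∀ j, G j) → ℂ :=
  fun γ => ∏ j, m j (component γ j)

end

end SidonWeight

open SidonWeight

namespace SidonWeight

/-! Write `t` for the tensor weight. By duality the square root on the left, over a finite set of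
characters, equals `∫ f * conj g` for some `g = ∑ b γ * t γ * γ` with `∑ ‖b γ‖ ^ 2 = 1`. So
everything rests on the moment bound `‖g‖_{2k} ≤ (∏ S j) * (8k)^{n/2}` for all `k`
(`integral_norm_sum_tensorWeight_pow_le`): it amounts to integrability of `exp (c |g|^{2/n})`, and
functions of this growth pair with `L log^{n/2} L` through a Young inequality
(`exists_mul_le_log_add_pow`).

The moment bound comes from randomizing signs. Attach a sign to every character of every factor, and
let `w γ` be the product of the `n` signs of the components of `γ`. By Hahn–Banach the Sidon
inequality says that, for any signs `σ`, the function `σ * m j` is on finite parts of the support a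
limit of Fourier transforms of discrete measures of mass at most `S j`
(`mem_closure_convexHull_of_sum_le`). Convolving with such measures in every variable costs at most
`∏ S j` in `L^{2k}`. As `w γ ^ 2 = 1`, the norm of `g` is therefore at most `∏ S j` times that of `∑
b γ * w γ * γ`, whatever the signs. Averaged over the signs at a fixed point, the latter is a
homogeneous polynomial of degree `n` in signs, and Bonami's inequality
(`sum_powerset_sum_sq_pow_le`) gives the growth `(8k)^{n/2}`. -/

/-! ### Hypercontractivity for polynomials in signs. -/

/-- From `1 ± x ≤ exp (± x)` the left side is at most `2 cosh (2kx) ≤ 2 exp (2k²x²)`, the `k`-th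
power of `exp (2kx²)` up to the factor 2; the smallness hypothesis lets this exponential be
linearized. -/
theorem add_pow_add_sub_pow_le_of_small {k : ℕ} {x : ℝ} (hx : 0 ≤ x)
    (hx1 : 8 * k * x ^ 2 ≤ 1) (hx2 : x ≤ 1) :
    ((1 + x) ^ 2) ^ k + ((1 - x) ^ 2) ^ k ≤ 2 * (1 + 8 * k * x ^ 2) ^ k := by
  have h1 : ((1 + x) ^ 2) ^ k ≤ Real.exp (2 * k * x) := by
    have : 1 + x ≤ Real.exp x := by linarith [Real.add_one_le_exp x]
    calc ((1 + x) ^ 2) ^ k ≤ ((Real.exp x) ^ 2) ^ k := by gcongr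
      _ = _ := by rw [← pow_mul, ← Real.exp_nat_mul]; push_cast; ring_nf
  have h2 : ((1 - x) ^ 2) ^ k ≤ Real.exp (-(2 * k * x)) := by
    have : 1 - x ≤ Real.exp (-x) := by linarith [Real.add_one_le_exp (-x)]
    have h0 : 0 ≤ 1 - x := by linarith
    calc ((1 - x) ^ 2) ^ k ≤ ((Real.exp (-x)) ^ 2) ^ k := by gcongr
      _ = _ := by rw [← pow_mul, ← Real.exp_nat_mul]; push_cast; ring_nf
  have h3 := Real.cosh_le_exp_half_sq (2 * k * x)
  rw [Real.cosh_eq] at h3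
  have h4 : Real.exp ((2 * k * x) ^ 2 / 2) = Real.exp (2 * k * x ^ 2) ^ k := by
    rw [← Real.exp_nat_mul]; ring_nf
  have h5 : Real.exp (2 * k * x ^ 2) ≤ 1 + 8 * k * x ^ 2 := by
    set y : ℝ := 2 * k * x ^ 2 with hy
    have hy0 : 0 ≤ y := by positivity
    have hy1 : y ≤ 1 / 4 := by linarith
    have h6 : 1 - y ≤ Real.exp (-y) := by linarith [Real.add_one_le_exp (-y)]
    have h7 : Real.exp y * Real.exp (-y) = 1 := by rw [← Real.exp_add]; simp
    have h8 : Real.exp y * (1 - y) ≤ 1 := by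
      exact (mul_le_mul_of_nonneg_left h6 (Real.exp_pos y).le).trans_eq h7
    have h9 : 8 * k * x ^ 2 = 4 * y := by rw [hy]; ring
    rw [h9]
    nlinarith [Real.exp_pos y]
  have h6 : Real.exp (2 * k * x ^ 2) ^ k ≤ (1 + 8 * k * x ^ 2) ^ k := by gcongr
  linarith

/-- The scalar two-point hypercontractive inequality, with a non-optimal constant. -/
theorem add_pow_add_sub_pow_le {k : ℕ} (hk : 1 ≤ k) {a b : ℝ} (ha : 0 ≤ a) (hb : 0 ≤ b) :
    ((a + b) ^ 2) ^ k + ((a - b) ^ 2) ^ k ≤ 2 * (a ^ 2 + 8 * k * b ^ 2) ^ k := by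
  have hk' : (1 : ℝ) ≤ k := by exact_mod_cast hk
  -- When `b` is comparatively large, each power alone is dominated by the right-hand base.
  -- Otherwise homogeneity reduces to `x = b / a`, which is small in the required sense.
  rcases le_total (a ^ 2) (8 * k * b ^ 2) with h | h
  · have hb2 : b ^ 2 ≤ k * b ^ 2 := by nlinarith [sq_nonneg b]
    have h1 : (a + b) ^ 2 ≤ a ^ 2 + 8 * k * b ^ 2 := by
      nlinarith [sq_nonneg (a - 2 * b)]
    have h2 : (a - b) ^ 2 ≤ a ^ 2 + 8 * k * b ^ 2 := by
      nlinarith [mul_nonneg ha hb]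
    have h3 : ((a + b) ^ 2) ^ k ≤ (a ^ 2 + 8 * k * b ^ 2) ^ k := by gcongr
    have h4 : ((a - b) ^ 2) ^ k ≤ (a ^ 2 + 8 * k * b ^ 2) ^ k := by gcongr
    linarith
  · rcases ha.eq_or_lt with rfl | ha
    · have hb0 : b = 0 := by
        have : b ^ 2 ≤ 0 := by nlinarith [sq_nonneg b]
        exact pow_eq_zero_iff (two_ne_zero) |>.1 (le_antisymm this (sq_nonneg b))
      subst hb0
      simp [two_mul]
    · have hx1 : 8 * k * (b / a) ^ 2 ≤ 1 := by
        rw [div_pow, ← mul_div_assoc, div_le_one (by positivity)]; exact h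
      have hx2 : b / a ≤ 1 := by
        have : (b / a) ^ 2 ≤ 1 := by nlinarith [sq_nonneg (b / a)]
        exact (sq_le_one_iff₀ (by positivity)).1 this
      have := add_pow_add_sub_pow_le_of_small (k := k) (by positivity) hx1 hx2
      have e1 : (a + b) ^ 2 = a ^ 2 * (1 + b / a) ^ 2 := by field_simp
      have e2 : (a - b) ^ 2 = a ^ 2 * (1 - b / a) ^ 2 := by field_simp
      have e3 : a ^ 2 + 8 * k * b ^ 2 = a ^ 2 * (1 + 8 * k * (b / a) ^ 2) := by field_simp
      rw [e1, e2, e3, mul_pow _ _ k, mul_pow _ _ k, mul_pow _ _ k, ← mul_add, mul_left_comm]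
      gcongr

/-- For `P ≥ 0`, the even function `t ↦ (P + t)^k + (P - t)^k` is monotone in `|t| ≤ P`. -/
theorem add_pow_add_sub_pow_mono {k : ℕ} {P t y : ℝ} (hty : |t| ≤ y) (hy : y ≤ P) :
    (P + t) ^ k + (P - t) ^ k ≤ (P + y) ^ k + (P - y) ^ k := by
  rcases (abs_nonneg t |>.trans hty).eq_or_lt with h0 | h0
  · have : t = 0 := by rw [← h0] at hty; exact abs_nonpos_iff.1 hty
    rw [this, ← h0]
  obtain ⟨h1, h2⟩ := abs_le.1 hty
  have hc := convexOn_pow (𝕜 := ℝ) k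
  have hp : P + y ∈ Set.Ici (0 : ℝ) := by simp; linarith
  have hm : P - y ∈ Set.Ici (0 : ℝ) := by simp; linarith
  -- These weights exhibit `P ± t` as convex combinations of `P + y` and `P - y`.
  have ha : 0 ≤ (y + t) / (2 * y) := div_nonneg (by linarith) (by linarith)
  have hb : 0 ≤ (y - t) / (2 * y) := div_nonneg (by linarith) (by linarith)
  have hab : (y + t) / (2 * y) + (y - t) / (2 * y) = 1 := by field_simp; ring
  have i1 := hc.2 hp hm ha hb hab
  have i2 := hc.2 hm hp ha hb hab
  simp only [smul_eq_mul] at i1 i2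
  have e1 : (y + t) / (2 * y) * (P + y) + (y - t) / (2 * y) * (P - y) = P + t := by
    field_simp; ring
  have e2 : (y + t) / (2 * y) * (P - y) + (y - t) / (2 * y) * (P + y) = P - t := by
    field_simp; ring
  rw [e1] at i1
  rw [e2] at i2
  calc _ ≤ _ := add_le_add i1 i2
    _ = ((y + t) / (2 * y) + (y - t) / (2 * y)) * ((P + y) ^ k + (P - y) ^ k) := by ring
    _ = _ := by rw [hab, one_mul]

/-- The two-point hypercontractive inequality for vectors. -/
theorem sum_add_sq_pow_add_sum_sub_sq_pow_le {L : Type*} [Fintype L] {k : ℕ} (hk : 1 ≤ k)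
    (u v : L → ℝ) :
    (∑ l, (u l + v l) ^ 2) ^ k + (∑ l, (u l - v l) ^ 2) ^ k ≤
      2 * (∑ l, u l ^ 2 + 8 * k * ∑ l, v l ^ 2) ^ k := by
  set U := ∑ l, u l ^ 2
  set V := ∑ l, v l ^ 2
  have hU : 0 ≤ U := by positivity
  have hV : 0 ≤ V := by positivity
  have e1 : ∑ l, (u l + v l) ^ 2 = (U + V) + 2 * ∑ l, u l * v l := by
    simp only [U, V, Finset.mul_sum, ← Finset.sum_add_distrib]
    exact Finset.sum_congr rfl fun _ _ => by ring
  have e2 : ∑ l, (u l - v l) ^ 2 = (U + V) - 2 * ∑ l, u l * v l := by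
    simp only [U, V, Finset.mul_sum, ← Finset.sum_add_distrib, ← Finset.sum_sub_distrib]
    exact Finset.sum_congr rfl fun _ _ => by ring
  -- Only `U`, `V` and the inner product enter. By monotonicity the inner product may be raised to
  -- its Cauchy–Schwarz bound, the case of parallel vectors, which is the scalar inequality for `√U`
  -- and `√V`.
  have hcs : |∑ l, u l * v l| ≤ √U * √V := by
    rw [← Real.sqrt_mul hU]
    exact Real.abs_le_sqrt (Finset.sum_mul_sq_le_sq_mul_sq _ _ _)
  have hsU := Real.sq_sqrt hU
  have hsV := Real.sq_sqrt hV
  rw [e1, e2]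
  have h1 : |2 * ∑ l, u l * v l| ≤ 2 * (√U * √V) := by
    rw [abs_mul, abs_two]; gcongr
  have h2 : 2 * (√U * √V) ≤ U + V := by nlinarith [sq_nonneg (√U - √V)]
  refine (add_pow_add_sub_pow_mono h1 h2).trans ?_
  have := add_pow_add_sub_pow_le hk (Real.sqrt_nonneg U) (Real.sqrt_nonneg V)
  rw [hsU, hsV] at this
  have f1 : U + V + 2 * (√U * √V) = (√U + √V) ^ 2 := by rw [add_sq, hsU, hsV]; ring
  have f2 : U + V - 2 * (√U * √V) = (√U - √V) ^ 2 := by rw [sub_sq, hsU, hsV]; ring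
  rw [f1, f2]
  exact this

/-- Hypercontractivity (Bonami) for vector-valued polynomials in signs; the signs are `-1` at the
elements of `B` and `1` elsewhere. -/
theorem sum_powerset_sum_sq_pow_le {α : Type*} [DecidableEq α] {k : ℕ} (hk : 1 ≤ k)
    (s : Finset α) : ∀ (L : Type) [Fintype L] (c : L → Finset α → ℝ),
    ∑ B ∈ s.powerset, (∑ l, (∑ A ∈ s.powerset, c l A * ∏ i ∈ A, if i ∈ B then -1 else 1) ^ 2) ^ k
      ≤ 2 ^ s.card * (∑ l, ∑ A ∈ s.powerset, (8 * k : ℝ) ^ A.card * c l A ^ 2) ^ k := by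
  induction s using Finset.induction_on with
  | empty => intro L _ c; simp
  | insert N s hN ih =>
    intro L _ c
    set w : Finset α → Finset α → ℝ := fun A B => ∏ i ∈ A, if i ∈ B then -1 else 1 with hw
    have w_eq : ∀ A B, (∏ i ∈ A, if i ∈ B then (-1 : ℝ) else 1) = w A B := fun _ _ => rfl
    have w_same : ∀ A ∈ s.powerset, ∀ B, w A (insert N B) = w A B := by
      intro A hA B
      refine Finset.prod_congr rfl fun i hi => ?_
      have : i ≠ N := fun h => hN (Finset.mem_powerset.1 hA (h ▸ hi))
      simp [this]
    have w_pos : ∀ A ∈ s.powerset, ∀ B ∈ s.powerset, w (insert N A) B = w A B := by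
      intro A hA B hB
      have hNA : N ∉ A := fun h => hN (Finset.mem_powerset.1 hA h)
      have hNB : N ∉ B := fun h => hN (Finset.mem_powerset.1 hB h)
      rw [← w_eq, Finset.prod_insert hNA, if_neg hNB, one_mul]
    have w_neg : ∀ A ∈ s.powerset, ∀ B, w (insert N A) (insert N B) = - w A B := by
      intro A hA B
      have hNA : N ∉ A := fun h => hN (Finset.mem_powerset.1 hA h)
      rw [← w_same A hA, ← w_eq, Finset.prod_insert hNA, if_pos (Finset.mem_insert_self _ _),
        neg_one_mul]
    -- In the sign at `N` the polynomial is `p ± q`. The two-point inequality leaves `|p|² + 8k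
    -- |q|²`, again the squared length of one vector-valued polynomial, with values indexed by `L ⊕
    -- L`; hence the vector-valued formulation.
    have key := ih (L ⊕ L) (Sum.elim c fun l A => √(8 * k) * c l (insert N A))
    simp only [w_eq] at key ⊢
    clear_value w
    simp only [Fintype.sum_sum_type, Sum.elim_inl, Sum.elim_inr] at key
    rw [Finset.sum_powerset_insert hN, Finset.card_insert_of_notMem hN, ← Finset.sum_add_distrib]
    have e_pos : ∀ B ∈ s.powerset, ∀ l, ∑ A ∈ (insert N s).powerset, c l A * w A B =
        ∑ A ∈ s.powerset, c l A * w A B + ∑ A ∈ s.powerset, c l (insert N A) * w A B := by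
      intro B hB l
      rw [Finset.sum_powerset_insert hN]
      congr 1
      exact Finset.sum_congr rfl fun A hA => by rw [w_pos A hA B hB]
    have e_neg : ∀ B, ∀ l, ∑ A ∈ (insert N s).powerset, c l A * w A (insert N B) =
        ∑ A ∈ s.powerset, c l A * w A B - ∑ A ∈ s.powerset, c l (insert N A) * w A B := by
      intro B l
      rw [Finset.sum_powerset_insert hN, sub_eq_add_neg, ← Finset.sum_neg_distrib]
      congr 1
      · exact Finset.sum_congr rfl fun A hA => by rw [w_same A hA B]
      · exact Finset.sum_congr rfl fun A hA => by rw [w_neg A hA B, mul_neg]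
    have e_sqrt : ∀ B, ∑ l, (∑ A ∈ s.powerset, √(8 * k) * c l (insert N A) * w A B) ^ 2 =
        8 * k * ∑ l, (∑ A ∈ s.powerset, c l (insert N A) * w A B) ^ 2 := by
      intro B
      rw [Finset.mul_sum]
      refine Finset.sum_congr rfl fun l _ => ?_
      simp only [mul_assoc √(8 * k : ℝ)]
      rw [← Finset.mul_sum, mul_pow, Real.sq_sqrt (by positivity)]
    calc _ ≤ ∑ B ∈ s.powerset, 2 * (∑ l, (∑ A ∈ s.powerset, c l A * w A B) ^ 2 +
            ∑ l, (∑ A ∈ s.powerset, √(8 * k) * c l (insert N A) * w A B) ^ 2) ^ k := by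
          refine Finset.sum_le_sum fun B hB => ?_
          simp only [e_pos B hB, e_neg, e_sqrt]
          exact sum_add_sq_pow_add_sum_sub_sq_pow_le hk _ _
      _ ≤ _ := by
          rw [← Finset.mul_sum]
          refine (mul_le_mul_of_nonneg_left key zero_le_two).trans_eq ?_
          rw [← mul_assoc, pow_succ']
          congr 2
          rw [← Finset.sum_add_distrib]
          refine Finset.sum_congr rfl fun l _ => ?_
          rw [Finset.sum_powerset_insert hN]
          congr 1
          refine Finset.sum_congr rfl fun A hA => ?_
          have hNA : N ∉ A := fun h => hN (Finset.mem_powerset.1 hA h)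
          rw [Finset.card_insert_of_notMem hNA, mul_pow √(8 * k : ℝ),
            Real.sq_sqrt (by positivity), pow_succ (8 * k : ℝ), mul_assoc _ (8 * k : ℝ)]

/-- Khinchine's inequality for homogeneous polynomials in signs with complex coefficients. -/
theorem sum_powerset_norm_sum_pow_le {α ι : Type*} [DecidableEq α] {k n : ℕ} (hk : 1 ≤ k)
    (s : Finset α) (T : Finset ι) (A : ι → Finset α) (hA : Set.InjOn A T)
    (hs : ∀ i ∈ T, A i ⊆ s) (hn : ∀ i ∈ T, (A i).card = n) (b : ι → ℂ) :
    ∑ B ∈ s.powerset, ‖∑ i ∈ T, b i * ∏ z ∈ A i, if z ∈ B then -1 else 1‖ ^ (2 * k) ≤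
      2 ^ s.card * ((8 * k : ℝ) ^ n * ∑ i ∈ T, ‖b i‖ ^ 2) ^ k := by
  set β : Bool → ι → ℝ := fun l i => if l = true then (b i).re else (b i).im with hβ
  set c : Bool → Finset α → ℝ := fun l D => ∑ i ∈ T, if A i = D then β l i else 0 with hc
  -- Injectivity of `A` on `T` leaves at most one nonzero term, so squaring creates no cross terms.
  have hc2 : ∀ l D, c l D ^ 2 = ∑ i ∈ T, if A i = D then β l i ^ 2 else 0 := by
    intro l D
    by_cases h : ∃ i ∈ T, A i = D
    · obtain ⟨i, hi, rfl⟩ := h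
      simp only [hc]
      rw [Finset.sum_eq_single i, Finset.sum_eq_single i]
      · simp
      · intro j hj hji
        rw [if_neg fun h => hji (hA hj hi h)]
      · exact fun h => (h hi).elim
      · intro j hj hji
        rw [if_neg fun h => hji (hA hj hi h)]
      · exact fun h => (h hi).elim
    · push Not at h
      simp only [hc]
      rw [Finset.sum_eq_zero fun i hi => if_neg (h i hi),
        Finset.sum_eq_zero fun i hi => if_neg (h i hi)]
      simp
  have key := sum_powerset_sum_sq_pow_le hk s Bool c
  have e1 : ∀ l, ∑ D ∈ s.powerset, (8 * k : ℝ) ^ D.card * c l D ^ 2 =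
      (8 * k) ^ n * ∑ i ∈ T, β l i ^ 2 := by
    intro l
    simp only [hc2, Finset.mul_sum]
    rw [Finset.sum_comm]
    refine Finset.sum_congr rfl fun i hi => ?_
    simp only [mul_ite, mul_zero]
    rw [Finset.sum_ite_eq, if_pos (Finset.mem_powerset.2 (hs i hi)), hn i hi]
  have e2 : ∀ l (B : Finset α), ∑ D ∈ s.powerset, c l D * (∏ z ∈ D, if z ∈ B then (-1 : ℝ) else 1) =
      ∑ i ∈ T, β l i * ∏ z ∈ A i, (if z ∈ B then (-1 : ℝ) else 1) := by
    intro l B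
    simp only [hc, Finset.sum_mul]
    rw [Finset.sum_comm]
    refine Finset.sum_congr rfl fun i hi => ?_
    simp only [ite_mul, zero_mul]
    rw [Finset.sum_ite_eq, if_pos (Finset.mem_powerset.2 (hs i hi))]
  simp only [e1, e2, Fintype.sum_bool] at key
  convert key using 1
  · refine Finset.sum_congr rfl fun B _ => ?_
    have hw : ∀ i, (∏ z ∈ A i, if z ∈ B then (-1 : ℂ) else 1) =
        ((∏ z ∈ A i, if z ∈ B then (-1 : ℝ) else 1 : ℝ) : ℂ) := by
      intro i
      rw [Complex.ofReal_prod]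
      exact Finset.prod_congr rfl fun z _ => by split_ifs <;> simp
    rw [pow_mul, ← Complex.normSq_eq_norm_sq, Complex.normSq_apply, ← sq, ← sq,
      Complex.re_sum, Complex.im_sum]
    simp only [hw, Complex.re_mul_ofReal, Complex.im_mul_ofReal, hβ, if_true,
      Bool.false_eq_true, if_false]
  · rw [← mul_add, ← Finset.sum_add_distrib]
    congr 4 with i
    rw [← Complex.normSq_eq_norm_sq, Complex.normSq_apply]
    simp [hβ, sq]

/-! ### A Young inequality adapted to `L log^{n/2} L`. -/

/-- A Young inequality for the pair `s log^{n/2}(1 + s)` and a function growing like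
`exp (c t^{2/n})`. -/
theorem exists_mul_le_log_add_pow (n : ℕ) {δ : ℝ} (hδ : 0 < δ) :
    ∃ A B C : ℝ, 0 < A ∧ 0 < B ∧ 0 < C ∧ ∀ s t : ℝ, 0 ≤ s → 0 ≤ t → ∃ k : ℕ,
      s * t ≤ A * (s * Real.log (1 + s) ^ ((n : ℝ) / 2)) + B +
        C * (δ * t ^ 2 / (8 * (k + 1)) ^ n) ^ (k + 1) := by
  set D : ℝ := √(Real.exp 4 * 8 ^ n / δ) with hD
  have hD0 : 0 < D := by positivity
  set C : ℝ := √(8 ^ n * n.factorial / δ) with hC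
  have hC0 : 0 < C := by positivity
  set P : ℝ := 2 ^ ((n : ℝ) / 2) with hP
  have hP0 : 0 < P := by positivity
  refine ⟨D * P, 2 * D * P, C, by positivity, by positivity, hC0, fun s t hs ht => ?_⟩
  have hℓ : 0 ≤ Real.log (1 + s) := Real.log_nonneg (by linarith)
  have hs_exp : 1 + s = Real.exp (Real.log (1 + s)) := (Real.exp_log (by linarith)).symm
  set ℓ : ℝ := Real.log (1 + s)
  -- The moment is chosen so that `κ = k + 1` lies between `log (1 + s)` and `1 + log (1 + s)`. If
  -- `y` is bounded, then `t` is at most a multiple of `κ^{n/2}` and the logarithmic term absorbs `s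
  -- * t`; if `y` is large, `y ^ κ` beats every power of `s` that occurs.
  refine ⟨⌊ℓ⌋₊, ?_⟩
  have hk1 : ℓ ≤ (⌊ℓ⌋₊ : ℝ) + 1 := (Nat.lt_floor_add_one ℓ).le
  have hk2 : (⌊ℓ⌋₊ : ℝ) + 1 ≤ 1 + ℓ := by linarith [Nat.floor_le hℓ]
  generalize ⌊ℓ⌋₊ = j at hk1 hk2
  set κ : ℝ := (j : ℝ) + 1 with hκ
  have hκ0 : 0 < κ := by positivity
  have hκ1 : 1 ≤ κ := by rw [hκ]; linarith [(Nat.cast_nonneg j : (0 : ℝ) ≤ j)]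
  set y : ℝ := δ * t ^ 2 / (8 * κ) ^ n with hy
  have hy0 : 0 ≤ y := by positivity
  have hyt : t ^ 2 = y * (8 * κ) ^ n / δ := by rw [hy]; field_simp
  have hlog : 0 ≤ s * ℓ ^ ((n : ℝ) / 2) := mul_nonneg hs (Real.rpow_nonneg hℓ _)
  rcases le_total y (Real.exp 4) with hle | hle
  · have htD : t ≤ D * κ ^ ((n : ℝ) / 2) := by
      refine le_of_sq_le_sq ?_ (by positivity)
      rw [mul_pow, hD, Real.sq_sqrt (by positivity), ← Real.rpow_natCast (κ ^ _) 2,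
        ← Real.rpow_mul hκ0.le, hyt, mul_pow]
      have : (n : ℝ) / 2 * (2 : ℕ) = (n : ℝ) := by push_cast; ring
      rw [this, Real.rpow_natCast]
      calc y * (8 ^ n * κ ^ n) / δ ≤ Real.exp 4 * (8 ^ n * κ ^ n) / δ := by gcongr
        _ = _ := by ring
    have hmain : s * κ ^ ((n : ℝ) / 2) ≤ P * (s * ℓ ^ ((n : ℝ) / 2)) + 2 * P := by
      rcases le_total 1 ℓ with h1 | h1
      · have : κ ^ ((n : ℝ) / 2) ≤ P * ℓ ^ ((n : ℝ) / 2) := by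
          rw [hP, ← Real.mul_rpow zero_le_two hℓ]
          exact Real.rpow_le_rpow hκ0.le (by linarith) (by positivity)
        nlinarith [mul_le_mul_of_nonneg_left this hs]
      -- Here `s ≤ e - 1 < 2`, which is what the additive constant pays for.
      · have h2 : κ ^ ((n : ℝ) / 2) ≤ P :=
          Real.rpow_le_rpow hκ0.le (by linarith) (by positivity)
        have h3 : s ≤ 2 := by
          have : Real.exp ℓ ≤ Real.exp 1 := Real.exp_le_exp.2 h1
          linarith [Real.exp_one_lt_d9]
        have : s * κ ^ ((n : ℝ) / 2) ≤ 2 * P := by gcongr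
        nlinarith
    have h4 : s * t ≤ D * (s * κ ^ ((n : ℝ) / 2)) := by
      calc s * t ≤ s * (D * κ ^ ((n : ℝ) / 2)) := by gcongr
        _ = _ := by ring
    have h5 : 0 ≤ C * y ^ (j + 1) := by positivity
    nlinarith [mul_le_mul_of_nonneg_left hmain hD0.le]
  · have hst : s * t ≤ C * y ^ (j + 1) := by
      refine le_of_sq_le_sq ?_ (by positivity)
      have h1 : s ≤ Real.exp κ := by
        have : Real.exp ℓ ≤ Real.exp κ := Real.exp_le_exp.2 hk1
        linarith
      have h2 : κ ^ n ≤ n.factorial * Real.exp κ := by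
        have := Real.pow_div_factorial_le_exp κ hκ0.le n
        rwa [div_le_iff₀' (by positivity)] at this
      -- Three factors `exp κ` are needed: two from `s ^ 2` and one from `κ ^ n ≤ n! * exp κ`. The
      -- threshold `exp 4` covers them with room to spare.
      have h3 : Real.exp κ ^ 3 ≤ y ^ (j + 1) := by
        have h6 : Real.exp κ ^ 4 = Real.exp 4 ^ (j + 1) := by
          rw [← Real.exp_nat_mul, ← Real.exp_nat_mul, hκ]; push_cast; ring_nf
        calc Real.exp κ ^ 3 ≤ Real.exp κ ^ 4 :=
              pow_le_pow_right₀ (Real.one_le_exp hκ0.le) (by norm_num)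
          _ = Real.exp 4 ^ (j + 1) := h6
          _ ≤ _ := by gcongr
      have hy1 : 1 ≤ y := (Real.one_le_exp (by norm_num)).trans hle
      have h4 : y ≤ y ^ (j + 1) := le_self_pow₀ hy1 (by simp)
      calc (s * t) ^ 2 = s ^ 2 * t ^ 2 := by ring
        _ = s ^ 2 * (y * (8 ^ n * κ ^ n) / δ) := by rw [hyt, mul_pow]
        _ ≤ Real.exp κ ^ 2 * (y ^ (j + 1) * (8 ^ n * (n.factorial * Real.exp κ)) / δ) := by
          gcongr
        _ = 8 ^ n * n.factorial / δ * (Real.exp κ ^ 3 * y ^ (j + 1)) := by ring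
        _ ≤ 8 ^ n * n.factorial / δ * (y ^ (j + 1) * y ^ (j + 1)) := by gcongr
        _ = _ := by rw [mul_pow, hC, Real.sq_sqrt (by positivity)]; ring
    have : 0 ≤ D * P * (s * ℓ ^ ((n : ℝ) / 2)) := by positivity
    have : 0 ≤ 2 * D * P := by positivity
    linarith

/-! ### Characters and the dual form of the Sidon inequality. -/

theorem integrable_of_continuous {G : Type*} [TopologicalSpace G] [CompactSpace G]
    [MeasurableSpace G] [BorelSpace G] {μ : Measure G} [IsFiniteMeasure μ] {E : Type*}
    [NormedAddCommGroup E] [SecondCountableTopology E] {f : G → E} (hf : Continuous f) :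
    Integrable f μ := by
  obtain ⟨C, hC⟩ := (isCompact_range hf).isBounded.exists_norm_le
  exact .of_bound hf.aestronglyMeasurable C (.of_forall fun x => hC _ ⟨x, rfl⟩)

section Characters

variable {G : Type*} [CommGroup G] [TopologicalSpace G]

theorem continuous_character (γ : PontryaginDual G) : Continuous (character γ) :=
  continuous_subtype_val.comp (map_continuous γ)

theorem norm_character (γ : PontryaginDual G) (x : G) : ‖character γ x‖ = 1 :=
  Circle.norm_coe _

theorem character_mul (γ : PontryaginDual G) (x y : G) :
    character γ (x * y) = character γ x * character γ y := by
  simp [character]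

theorem character_mul_star (γ χ : PontryaginDual G) (x : G) :
    character γ x * (starRingEnd ℂ) (character χ x) = character (γ / χ) x := by
  have : character (γ / χ) x * character χ x = character γ x := by
    change (((γ / χ) x : Circle) : ℂ) * ((χ x : Circle) : ℂ) = ((γ x : Circle) : ℂ)
    rw [← Circle.coe_mul]
    congr 1
    exact DFunLike.congr_fun (div_mul_cancel γ χ) x
  rw [← this, mul_assoc, Complex.mul_conj, Complex.normSq_eq_norm_sq, norm_character]
  simp

/-- Duality: under the Sidon inequality, bounded multiples of `m` are, on finite sets, limits of
Fourier transforms of finitely supported measures of mass `≤ S`. -/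
theorem mem_closure_convexHull_of_sum_le {m : PontryaginDual G → ℂ} {S : ℝ} (hS : 0 < S)
    {F : Finset (PontryaginDual G)}
    (h : ∀ (b : PontryaginDual G → ℂ) (M : ℝ), (∀ x, ‖∑ χ ∈ F, b χ * character χ x‖ ≤ M) →
      ∑ χ ∈ F, ‖m χ * b χ‖ ≤ S * M)
    {σ : PontryaginDual G → ℂ} (hσ : ∀ χ, ‖σ χ‖ ≤ 1) :
    (fun χ : F => σ χ * m χ) ∈ closure (convexHull ℝ
      {w : F → ℂ | ∃ (u : ℂ) (x : G), ‖u‖ = S ∧ w = fun χ : F => u * character χ.1 x}) := by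
  classical
  by_contra hmem
  -- A separating functional has a coefficient vector `b`. Testing it at `S * u * χ x`, with `u` the
  -- phase aligning the sum, bounds the polynomial `∑ b χ * χ` by `r / S`; the Sidon inequality then
  -- bounds its value at `σ * m` by `r`, contradicting separation.
  obtain ⟨f, r, hf1, hf2⟩ := RCLike.geometric_hahn_banach_closed_point (𝕜 := ℂ)
    (convex_convexHull ℝ _).closure isClosed_closure hmem
  set b : PontryaginDual G → ℂ := fun χ => if hχ : χ ∈ F then f (Pi.single ⟨χ, hχ⟩ 1) else 0 with hb
  have hfw : ∀ w : PontryaginDual G → ℂ, f (fun χ : F => w χ) = ∑ χ ∈ F, w χ * b χ := by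
    intro w
    have : (fun χ : F => w χ) = ∑ χ : F, w χ • (Pi.single χ (1 : ℂ) : F → ℂ) := by
      ext χ
      simp [Finset.sum_apply, Pi.single_apply]
    rw [this, map_sum, ← Finset.sum_coe_sort F]
    refine Finset.sum_congr rfl fun χ _ => ?_
    rw [map_smul, smul_eq_mul]
    simp [hb]
  have hbound : ∀ x, ‖∑ χ ∈ F, b χ * character χ x‖ ≤ r / S := by
    intro x
    set z := ∑ χ ∈ F, b χ * character χ x with hz
    obtain ⟨u, hu, huz⟩ : ∃ u : ℂ, ‖u‖ = 1 ∧ u * z = ‖z‖ := by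
      by_cases hz0 : z = 0
      · exact ⟨1, by simp, by simp [hz0]⟩
      · refine ⟨(starRingEnd ℂ) z / ‖z‖, by simp [hz0], ?_⟩
        have : (‖z‖ : ℂ) ≠ 0 := by simpa using hz0
        rw [div_mul_eq_mul_div, mul_comm, Complex.mul_conj, Complex.normSq_eq_norm_sq]
        push_cast
        field_simp
    have h1 := hf1 (fun χ : F => (S * u) * character χ.1 x)
      (subset_closure (subset_convexHull ℝ _ ⟨S * u, x, by simp [hu, abs_of_pos hS], rfl⟩))
    rw [hfw fun χ => (S * u) * character χ x] at h1
    have h2 : ∑ χ ∈ F, (S * u) * character χ x * b χ = ((S * ‖z‖ : ℝ) : ℂ) := by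
      push_cast
      rw [← huz, hz, Finset.mul_sum, Finset.mul_sum]
      exact Finset.sum_congr rfl fun _ _ => by ring
    rw [h2] at h1
    rw [le_div_iff₀' hS]
    exact (show S * ‖z‖ < r from h1).le
  have h3 := h b _ hbound
  rw [mul_div_cancel₀ _ hS.ne'] at h3
  rw [hfw fun χ => σ χ * m χ] at hf2
  have h4 : (∑ χ ∈ F, σ χ * m χ * b χ).re ≤ ∑ χ ∈ F, ‖m χ * b χ‖ := by
    refine (Complex.re_le_norm _).trans ((norm_sum_le _ _).trans ?_)
    refine Finset.sum_le_sum fun χ _ => ?_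
    rw [mul_assoc, norm_mul]
    exact mul_le_of_le_one_left (norm_nonneg _) (hσ χ)
  exact absurd hf2 (not_lt.2 (h4.trans h3))

theorem integral_character_mul_star [IsTopologicalGroup G] [MeasurableSpace G] [BorelSpace G] (μ : Measure G)
    [IsProbabilityMeasure μ] [μ.IsMulLeftInvariant] (γ χ : PontryaginDual G)
    [Decidable (γ = χ)] :
    ∫ x, character γ x * (starRingEnd ℂ) (character χ x) ∂μ = if γ = χ then 1 else 0 := by
  simp only [character_mul_star]
  split_ifs with h
  · subst h
    have : ∀ x, character (1 : PontryaginDual G) x = 1 := fun x => by simp [character]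
    simp [this]
  · obtain ⟨y, hy⟩ : ∃ y, character (γ / χ) y ≠ 1 := by
      by_contra! hne
      refine h (div_eq_one.1 (PontryaginDual.ext fun x => ?_))
      exact Circle.ext (by simpa [character] using hne x)
    have h1 := integral_mul_left_eq_self (μ := μ) (character (γ / χ)) y
    simp only [character_mul] at h1
    rw [integral_const_mul] at h1
    have h2 : (character (γ / χ) y - 1) * ∫ x, character (γ / χ) x ∂μ = 0 := by
      rw [sub_mul, h1, one_mul, sub_self]
    exact (mul_eq_zero.1 h2).resolve_left (sub_ne_zero.2 hy)

variable [IsTopologicalGroup G] [CompactSpace G]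

theorem fourierTransform_sum_smul_character (F : Finset (PontryaginDual G))
    (b : PontryaginDual G → ℂ) (χ : PontryaginDual G) [Decidable (χ ∈ F)] :
    fourierTransform (fun x => ∑ γ ∈ F, b γ * character γ x) χ = if χ ∈ F then b χ else 0 := by
  classical
  let : MeasurableSpace G := borel G
  have : BorelSpace G := ⟨rfl⟩
  have : IsProbabilityMeasure (haarProb G) := ⟨haarProb_univ G⟩
  have : (haarProb G).IsMulLeftInvariant :=
    inferInstanceAs (Measure.haarMeasure _).IsMulLeftInvariant
  unfold fourierTransform
  simp only [Finset.sum_mul, mul_assoc]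
  rw [integral_finsetSum]
  · simp only [integral_const_mul, integral_character_mul_star, mul_ite, mul_one, mul_zero,
      Finset.sum_ite_eq']
    by_cases h : χ ∈ F <;> simp [h]
  · intro γ _
    refine (integrable_of_continuous ?_).const_mul _
    exact (continuous_character γ).mul (Complex.continuous_conj.comp (continuous_character χ))

/-- The Sidon inequality for an explicitly given trigonometric polynomial. -/
theorem IsSidonWeight.exists_sum_le {m : PontryaginDual G → ℂ} (hm : IsSidonWeight m) :
    ∃ S : ℝ, 0 < S ∧ ∀ (F : Finset (PontryaginDual G)) (b : PontryaginDual G → ℂ) (M : ℝ),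
      (∀ χ ∈ F, m χ ≠ 0) → (∀ x, ‖∑ χ ∈ F, b χ * character χ x‖ ≤ M) →
      ∑ χ ∈ F, ‖m χ * b χ‖ ≤ S * M := by
  classical
  obtain ⟨S, hS, h⟩ := hm
  refine ⟨S, hS, fun F b M hF hM => ?_⟩
  set f : G → ℂ := fun x => ∑ χ ∈ F, b χ * character χ x with hf
  have hft : ∀ χ, fourierTransform f χ = if χ ∈ F then b χ else 0 :=
    fun χ => fourierTransform_sum_smul_character F b χ
  have hpoly : IsTrigPolynomial f := by
    have : f = ∑ χ ∈ F, b χ • character χ := by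
      ext x; simp [hf]
    rw [IsTrigPolynomial, this]
    exact Submodule.sum_mem _ fun χ _ =>
      Submodule.smul_mem _ _ (Submodule.subset_span ⟨χ, rfl⟩)
  have hsupp : Function.support (fourierTransform f) ⊆ Function.support m := by
    intro χ hχ
    rw [Function.mem_support, hft] at hχ
    exact hF χ (by by_contra hn; simp [hn] at hχ)
  have hM0 : 0 ≤ M := (norm_nonneg _).trans (hM 1)
  have key := h f hpoly hsupp
  have h1 : eLpNorm f ∞ (haarProb G) ≤ ENNReal.ofReal M := by
    rw [eLpNorm_exponent_top]
    exact eLpNormEssSup_le_of_ae_bound (Filter.Eventually.of_forall hM)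
  have h2 : ∑ χ ∈ F, ‖m χ * b χ‖ₑ ≤
      ∑' γ : Function.support m, ‖m γ * fourierTransform f γ‖ₑ := by
    rw [tsum_subtype (Function.support m) fun γ => ‖m γ * fourierTransform f γ‖ₑ]
    refine le_trans (le_of_eq ?_) (ENNReal.sum_le_tsum F)
    refine Finset.sum_congr rfl fun χ hχ => ?_
    rw [Set.indicator_of_mem (hF χ hχ : χ ∈ Function.support m), hft, if_pos hχ]
  have h3 : ENNReal.ofReal (∑ χ ∈ F, ‖m χ * b χ‖) ≤ ENNReal.ofReal (S * M) := by
    rw [ENNReal.ofReal_sum_of_nonneg fun _ _ => norm_nonneg _, ENNReal.ofReal_mul hS.le]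
    simp only [ofReal_norm]
    exact (h2.trans key).trans (by gcongr)
  exact (ENNReal.ofReal_le_ofReal_iff (by positivity)).1 h3

end Characters

/-! ### Moment bounds on the product group. -/

theorem character_hom_mul {G H : Type*} [CommGroup G] [TopologicalSpace G] [CommGroup H]
    [TopologicalSpace H] (ι : H →ₜ* G) (γ : PontryaginDual G) (y : H) (x : G) :
    character γ (ι y * x) = character (PontryaginDual.map ι γ) y * character γ x :=
  character_mul γ (ι y) x

/-- Multiplying the coefficients by the Fourier transform of a measure of mass `≤ S` on a
subgroup (in the weak form of a limit of convex combinations) increases the `L^p` norm at most by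
the factor `S`. -/
theorem integral_norm_sum_pow_le_of_mem_closure {G H : Type*} [CommGroup G] [TopologicalSpace G]
    [IsTopologicalGroup G] [CompactSpace G] [MeasurableSpace G] [BorelSpace G] (μ : Measure G)
    [IsFiniteMeasure μ] [μ.IsMulLeftInvariant] [CommGroup H] [TopologicalSpace H]
    [DecidableEq (PontryaginDual H)]
    (ι : H →ₜ* G) (S : ℝ) (p : ℕ) (T : Finset (PontryaginDual G)) (c : PontryaginDual H → ℂ)
    (hc : (fun χ : T.image (PontryaginDual.map ι) => c χ) ∈ closure (convexHull ℝ
      {w : T.image (PontryaginDual.map ι) → ℂ | ∃ (u : ℂ) (y : H), ‖u‖ = S ∧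
        w = fun χ : T.image (PontryaginDual.map ι) => u * character χ.1 y}))
    (a : PontryaginDual G → ℂ) :
    ∫ x, ‖∑ γ ∈ T, a γ * c (PontryaginDual.map ι γ) * character γ x‖ ^ p ∂μ ≤
      S ^ p * ∫ x, ‖∑ γ ∈ T, a γ * character γ x‖ ^ p ∂μ := by
  set F := T.image (PontryaginDual.map ι) with hF
  have hmemF : ∀ γ : T, PontryaginDual.map ι γ.1 ∈ F := fun γ => Finset.mem_image_of_mem _ γ.2
  let g : (F → ℂ) → G → ℂ := fun v x =>
    ∑ γ : T, a γ * v ⟨PontryaginDual.map ι γ.1, hmemF γ⟩ * character γ.1 x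
  have hg : Continuous g.uncurry := by
    refine continuous_finsetSum _ fun γ _ => ?_
    exact (continuous_const.mul ((continuous_apply _).comp continuous_fst)).mul
      ((continuous_character _).comp continuous_snd)
  have hgv : ∀ v, Continuous (g v) := fun v => hg.comp (Continuous.prodMk_right v)
  have hgi : ∀ v, Integrable (fun x => ‖g v x‖ ^ p) μ := fun v =>
    integrable_of_continuous ((hgv v).norm.pow p)
  let Φ : (F → ℂ) → ℝ := fun v => ∫ x, ‖g v x‖ ^ p ∂μ
  have hΦc : Continuous Φ := by
    have := continuous_parametric_integral_of_continuous (μ := μ)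
      (f := fun v x => ‖g v x‖ ^ p) (hg.norm.pow p) isCompact_univ
    simpa [Φ] using this
  have hΦconv : ConvexOn ℝ Set.univ Φ := by
    refine ⟨convex_univ, fun v _ w _ α β hα hβ hαβ => ?_⟩
    have hlin : ∀ x, g (α • v + β • w) x = α • g v x + β • g w x := by
      intro x
      simp only [g, Finset.smul_sum, ← Finset.sum_add_distrib]
      refine Finset.sum_congr rfl fun γ _ => ?_
      simp only [Pi.add_apply, Pi.smul_apply, Complex.real_smul]
      ring
    have hp : ConvexOn ℝ Set.univ fun z : ℂ => ‖z‖ ^ p :=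
      (convexOn_norm convex_univ).pow (fun _ _ => norm_nonneg _) p
    calc Φ (α • v + β • w) ≤ ∫ x, (α * ‖g v x‖ ^ p + β * ‖g w x‖ ^ p) ∂μ := by
          refine integral_mono (hgi _) (((hgi v).const_mul α).add ((hgi w).const_mul β)) fun x => ?_
          simp only [hlin]
          exact hp.2 trivial trivial hα hβ hαβ
      _ = _ := by
          rw [integral_add ((hgi v).const_mul α) ((hgi w).const_mul β), integral_const_mul,
            integral_const_mul]
          rfl
  set M := S ^ p * ∫ x, ‖∑ γ ∈ T, a γ * character γ x‖ ^ p ∂μ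
  -- `Φ` is continuous and convex, so its sublevel set is closed and convex, and only the generators
  -- need checking. There the polynomial is translated by `ι y` and multiplied by `u`, so invariance
  -- of `μ` gives equality.
  have hsub : closure (convexHull ℝ {w : F → ℂ | ∃ (u : ℂ) (y : H), ‖u‖ = S ∧
      w = fun χ : F => u * character χ.1 y}) ⊆ {v | Φ v ≤ M} := by
    refine closure_minimal (convexHull_min ?_ ?_) (isClosed_le hΦc continuous_const)
    · rintro _ ⟨u, y, hu, rfl⟩
      have h1 : ∀ x, g (fun χ : F => u * character χ.1 y) x =
          u * ∑ γ ∈ T, a γ * character γ (ι y * x) := by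
        intro x
        simp only [g, character_hom_mul, Finset.mul_sum]
        rw [← Finset.sum_coe_sort T]
        exact Finset.sum_congr rfl fun γ _ => by ring
      rw [Set.mem_ofPred_eq]
      refine le_of_eq ?_
      simp only [Φ, h1, norm_mul, mul_pow, hu]
      rw [integral_const_mul,
        integral_mul_left_eq_self (μ := μ) (fun x => ‖∑ γ ∈ T, a γ * character γ x‖ ^ p) (ι y)]
    · simpa using hΦconv.convex_le M
  have := hsub hc
  simp only [Set.mem_ofPred_eq, Φ, g] at this
  refine le_trans (le_of_eq ?_) this
  refine integral_congr_ae (.of_forall fun x => ?_)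
  beta_reduce
  rw [← Finset.sum_coe_sort T]

section Tensor

variable {n : ℕ} {G : Fin n → Type*} [∀ j, CommGroup (G j)] [∀ j, TopologicalSpace (G j)]

theorem component_injective :
    Function.Injective (component : PontryaginDual (∀ j, G j) → ∀ j, PontryaginDual (G j)) := by
  intro γ χ h
  refine PontryaginDual.ext fun x => ?_
  rw [apply_eq_prod_component, apply_eq_prod_component, h]

variable [∀ j, IsTopologicalGroup (G j)] [∀ j, CompactSpace (G j)]
  [MeasurableSpace (∀ j, G j)] [BorelSpace (∀ j, G j)] (μ : Measure (∀ j, G j))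
  [IsProbabilityMeasure μ] [μ.IsMulLeftInvariant]

/-- The coordinates are treated one at a time, each through translations along the subgroup `G j` of
the product. Only invariance of `μ` is used, so no product measure or Fubini argument is needed. -/
theorem integral_norm_sum_prod_pow_le {m : ∀ j, PontryaginDual (G j) → ℂ} {S : Fin n → ℝ}
    (hS : ∀ j, 0 < S j)
    (hm : ∀ j (F : Finset (PontryaginDual (G j))) (b : PontryaginDual (G j) → ℂ) (M : ℝ),
      (∀ χ ∈ F, m j χ ≠ 0) → (∀ x, ‖∑ χ ∈ F, b χ * character χ x‖ ≤ M) →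
      ∑ χ ∈ F, ‖m j χ * b χ‖ ≤ S j * M)
    {σ : ∀ j, PontryaginDual (G j) → ℂ} (hσ : ∀ j χ, ‖σ j χ‖ ≤ 1) (p : ℕ)
    {T : Finset (PontryaginDual (∀ j, G j))} (hT : ∀ γ ∈ T, tensorWeight m γ ≠ 0)
    (J : Finset (Fin n)) (a : PontryaginDual (∀ j, G j) → ℂ) :
    ∫ x, ‖∑ γ ∈ T, a γ * (∏ j ∈ J, σ j (component γ j) * m j (component γ j)) *
        character γ x‖ ^ p ∂μ ≤
      (∏ j ∈ J, S j) ^ p * ∫ x, ‖∑ γ ∈ T, a γ * character γ x‖ ^ p ∂μ := by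
  classical
  induction J using Finset.induction_on generalizing a with
  | empty => simp
  | insert j J hj ih =>
    let ι : G j →ₜ* (∀ i, G i) := ⟨MonoidHom.mulSingle G j, continuous_mulSingle j⟩
    have hT' : ∀ χ ∈ T.image (PontryaginDual.map ι), m j χ ≠ 0 := by
      intro χ hχ
      obtain ⟨γ, hγ, rfl⟩ := Finset.mem_image.1 hχ
      exact Finset.prod_ne_zero_iff.1 (hT γ hγ) j (Finset.mem_univ j)
    have hmem := mem_closure_convexHull_of_sum_le (hS j)
      (fun b M => hm j (T.image (PontryaginDual.map ι)) b M hT') (hσ j)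
    have h1 := integral_norm_sum_pow_le_of_mem_closure μ ι (S j) p T (fun χ => σ j χ * m j χ) hmem
      (fun γ => a γ * ∏ j ∈ J, σ j (component γ j) * m j (component γ j))
    rw [Finset.prod_insert hj, mul_pow, mul_assoc]
    refine le_trans (le_of_eq ?_) (h1.trans
      (mul_le_mul_of_nonneg_left (ih a) (pow_nonneg (hS j).le p)))
    refine integral_congr_ae (.of_forall fun x => ?_)
    beta_reduce
    congr 2
    refine Finset.sum_congr rfl fun γ _ => ?_
    rw [Finset.prod_insert hj]
    change _ = _ * (σ j (component γ j) * m j (component γ j)) * _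
    ring

/-- The `L^{2k}` bound, with the growth `k^{n/2}` in `k`, for polynomials whose coefficients are
square summable up to the weight `m₁ ⊗ ⋯ ⊗ mₙ`. -/
theorem integral_norm_sum_tensorWeight_pow_le {m : ∀ j, PontryaginDual (G j) → ℂ} {S : Fin n → ℝ}
    (hS : ∀ j, 0 < S j)
    (hm : ∀ j (F : Finset (PontryaginDual (G j))) (b : PontryaginDual (G j) → ℂ) (M : ℝ),
      (∀ χ ∈ F, m j χ ≠ 0) → (∀ x, ‖∑ χ ∈ F, b χ * character χ x‖ ≤ M) →
      ∑ χ ∈ F, ‖m j χ * b χ‖ ≤ S j * M)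
    {k : ℕ} (hk : 1 ≤ k)
    {T : Finset (PontryaginDual (∀ j, G j))} (hT : ∀ γ ∈ T, tensorWeight m γ ≠ 0)
    (b : PontryaginDual (∀ j, G j) → ℂ) :
    ∫ x, ‖∑ γ ∈ T, b γ * tensorWeight m γ * character γ x‖ ^ (2 * k) ∂μ ≤
      (∏ j, S j) ^ (2 * k) * ((8 * k : ℝ) ^ n * ∑ γ ∈ T, ‖b γ‖ ^ 2) ^ k := by
  classical
  -- The signs are indexed by characters tagged with their factor. The tags keep the `n` components
  -- of `γ` distinct, so every monomial has degree exactly `n`, and the set determines `γ`.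
  let A : PontryaginDual (∀ j, G j) → Finset (Σ j, PontryaginDual (G j)) := fun γ =>
    Finset.univ.image fun j => ⟨j, component γ j⟩
  have hinj : ∀ γ : PontryaginDual (∀ j, G j),
      Function.Injective fun j => (⟨j, component γ j⟩ : Σ j, PontryaginDual (G j)) :=
    fun γ i j h => congrArg Sigma.fst h
  have hA : Set.InjOn A T := by
    intro γ _ χ _ h
    refine component_injective (funext fun j => ?_)
    have h1 : (⟨j, component γ j⟩ : Σ j, PontryaginDual (G j)) ∈ A χ :=
      h ▸ Finset.mem_image_of_mem _ (Finset.mem_univ j)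
    obtain ⟨i, _, hi⟩ := Finset.mem_image.1 h1
    cases congrArg Sigma.fst hi
    simpa using hi.symm
  have hcard : ∀ γ ∈ T, (A γ).card = n := by
    intro γ _
    rw [Finset.card_image_of_injective _ (hinj γ)]
    simp
  set s := T.biUnion A
  have hs : ∀ γ ∈ T, A γ ⊆ s := fun γ hγ => Finset.subset_biUnion_of_mem A hγ
  let w : PontryaginDual (∀ j, G j) → Finset (Σ j, PontryaginDual (G j)) → ℂ :=
    fun γ B => ∏ z ∈ A γ, if z ∈ B then -1 else 1
  let σ : Finset (Σ j, PontryaginDual (G j)) → ∀ j, PontryaginDual (G j) → ℂ :=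
    fun B j χ => if (⟨j, χ⟩ : Σ j, PontryaginDual (G j)) ∈ B then -1 else 1
  have hσ : ∀ B j χ, ‖σ B j χ‖ ≤ 1 := by
    intro B j χ
    simp only [σ]
    split_ifs <;> simp
  have hw : ∀ γ B, w γ B = ∏ j, σ B j (component γ j) := fun γ B =>
    Finset.prod_image fun i _ j _ h => hinj γ h
  have hσ2 : ∀ B j χ, σ B j χ * σ B j χ = 1 := by
    intro B j χ
    simp only [σ]
    split_ifs <;> simp
  have hw2 : ∀ γ B, w γ B * w γ B = 1 := by
    intro γ B
    rw [hw, ← Finset.prod_mul_distrib]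
    exact Finset.prod_eq_one fun j _ => hσ2 B j _
  set I := ∫ x, ‖∑ γ ∈ T, b γ * tensorWeight m γ * character γ x‖ ^ (2 * k) ∂μ
  set P := (∏ j, S j) ^ (2 * k)
  have hP : 0 ≤ P := by
    have : ∀ j, 0 ≤ S j := fun j => (hS j).le
    exact pow_nonneg (Finset.prod_nonneg fun j _ => this j) _
  -- Since `w γ B ^ 2 = 1`, the coefficient `b γ * t γ` equals `(b γ * w γ B) * (w γ B * t γ)`, and
  -- the last factor is the product of the signed weights removed by the preceding lemma.
  have hB : ∀ B ∈ s.powerset,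
      I ≤ P * ∫ x, ‖∑ γ ∈ T, b γ * w γ B * character γ x‖ ^ (2 * k) ∂μ := by
    intro B _
    refine le_trans (le_of_eq ?_) (integral_norm_sum_prod_pow_le μ hS hm (hσ B) (2 * k) hT
      Finset.univ fun γ => b γ * w γ B)
    refine integral_congr_ae (.of_forall fun x => ?_)
    beta_reduce
    congr 2
    refine Finset.sum_congr rfl fun γ _ => ?_
    rw [Finset.prod_mul_distrib, ← hw, tensorWeight]
    linear_combination (- b γ * (∏ j, m j (component γ j)) * character γ x) * hw2 γ B
  have hint : ∀ B, Integrable (fun x => ‖∑ γ ∈ T, b γ * w γ B * character γ x‖ ^ (2 * k)) μ :=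
    fun B => integrable_of_continuous ((continuous_finsetSum _ fun γ _ =>
      continuous_const.mul (continuous_character γ)).norm.pow _)
  set R := ((8 * k : ℝ) ^ n * ∑ γ ∈ T, ‖b γ‖ ^ 2) ^ k
  have hav : ∑ B ∈ s.powerset, ∫ x, ‖∑ γ ∈ T, b γ * w γ B * character γ x‖ ^ (2 * k) ∂μ ≤
      2 ^ s.card * R := by
    rw [← integral_finsetSum _ fun B _ => hint B]
    calc _ ≤ ∫ _, 2 ^ s.card * R ∂μ := by
          refine integral_mono (integrable_finsetSum _ fun B _ => hint B)
            (integrable_const _) fun x => ?_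
          -- At fixed `x` the factor `character γ x` is unimodular, so it joins the coefficient
          -- without changing the bound.
          have := sum_powerset_norm_sum_pow_le hk s T A hA hs hcard
            fun γ => b γ * character γ x
          simp only [norm_mul, norm_character, mul_one] at this
          refine le_trans (le_of_eq ?_) this
          refine Finset.sum_congr rfl fun B _ => ?_
          congr 2
          exact Finset.sum_congr rfl fun γ _ => mul_right_comm _ _ _
      _ = _ := by simp
  have htot : 2 ^ s.card * I ≤ P * (2 ^ s.card * R) := by
    calc 2 ^ s.card * I = ∑ B ∈ s.powerset, I := by simp
      _ ≤ _ := Finset.sum_le_sum hB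
      _ ≤ _ := by rw [← Finset.mul_sum]; exact mul_le_mul_of_nonneg_left hav hP
  have h2 : (0 : ℝ) < 2 ^ s.card := by positivity
  rw [mul_left_comm] at htot
  exact le_of_mul_le_mul_left htot h2

end Tensor

/-! ### The multiplier inequality. -/

section Tensor

variable {n : ℕ} {G : Fin n → Type*} [∀ j, CommGroup (G j)] [∀ j, TopologicalSpace (G j)]
  [∀ j, IsTopologicalGroup (G j)] [∀ j, CompactSpace (G j)]

/-- The multiplier inequality for finite sets of characters. -/
theorem exists_ofReal_sqrt_sum_le [MeasurableSpace (∀ j, G j)] [BorelSpace (∀ j, G j)]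
    (μ : Measure (∀ j, G j)) [IsProbabilityMeasure μ] [μ.IsMulLeftInvariant]
    {m : ∀ j, PontryaginDual (G j) → ℂ} {S : Fin n → ℝ} (hS : ∀ j, 0 < S j)
    (hm : ∀ j (F : Finset (PontryaginDual (G j))) (b : PontryaginDual (G j) → ℂ) (M : ℝ),
      (∀ χ ∈ F, m j χ ≠ 0) → (∀ x, ‖∑ χ ∈ F, b χ * character χ x‖ ≤ M) →
      ∑ χ ∈ F, ‖m j χ * b χ‖ ≤ S j * M) :
    ∃ A B : ℝ, 0 < A ∧ 0 < B ∧ ∀ f : (∀ j, G j) → ℂ, Integrable f μ →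
      ∀ T : Finset (PontryaginDual (∀ j, G j)), (∀ γ ∈ T, tensorWeight m γ ≠ 0) →
      ENNReal.ofReal √(∑ γ ∈ T, ‖tensorWeight m γ *
          ∫ x, f x * (starRingEnd ℂ) (character γ x) ∂μ‖ ^ 2) ≤
        ENNReal.ofReal A *
          ∫⁻ x, ENNReal.ofReal (‖f x‖ * Real.log (1 + ‖f x‖) ^ ((n : ℝ) / 2)) ∂μ +
        ENNReal.ofReal B := by
  set P := ∏ j, S j
  have hP : 0 < P := Finset.prod_pos fun j _ => hS j
  obtain ⟨A, B, C, hA, hB, hC, hyoung⟩ :=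
    -- With this `δ` one has `δ * P ^ 2 = 1 / 2`, so the `k`-th Young term has integral at most `(1
    -- / 2) ^ (k + 1)`. The looser bound `(1 / 2) ^ k` is summed, which gives the 2 in `B + C * 2`.
    exists_mul_le_log_add_pow n (δ := 1 / (2 * P ^ 2)) (by positivity)
  set δ := 1 / (2 * P ^ 2) with hδ
  refine ⟨A, B + C * 2, hA, by positivity, fun f hf T hT => ?_⟩
  set fh : PontryaginDual (∀ j, G j) → ℂ :=
    fun γ => ∫ x, f x * (starRingEnd ℂ) (character γ x) ∂μ
  set t := tensorWeight m
  set Q := √(∑ γ ∈ T, ‖t γ * fh γ‖ ^ 2) with hQ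
  have hQn : 0 ≤ Q := Real.sqrt_nonneg _
  rcases hQn.eq_or_lt with hQ0 | hQ0
  · rw [← hQ0]; simp
  have hQ2 : ∑ γ ∈ T, ‖t γ * fh γ‖ ^ 2 = Q ^ 2 := by
    rw [hQ, Real.sq_sqrt (by positivity)]
  -- The extremal unit vector for `ℓ²` duality: with it `∫ f * conj g` is exactly `Q`.
  set b : PontryaginDual (∀ j, G j) → ℂ := fun γ => fh γ * (starRingEnd ℂ) (t γ) / Q with hb
  have hb1 : ∑ γ ∈ T, ‖b γ‖ ^ 2 = 1 := by
    have : ∀ γ, ‖b γ‖ ^ 2 = ‖t γ * fh γ‖ ^ 2 / Q ^ 2 := by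
      intro γ
      simp only [hb, norm_div, norm_mul, RCLike.norm_conj, Complex.norm_real, Real.norm_eq_abs,
        abs_of_pos hQ0, div_pow]
      rw [mul_comm]
    simp only [this]
    rw [← Finset.sum_div, hQ2, div_self (by positivity)]
  set g : (∀ j, G j) → ℂ := fun x => ∑ γ ∈ T, b γ * t γ * character γ x with hg
  have hgc : Continuous g :=
    continuous_finsetSum _ fun γ _ => continuous_const.mul (continuous_character γ)
  have hpair : ∫ x, f x * (starRingEnd ℂ) (g x) ∂μ = Q := by
    have hfi : ∀ γ : PontryaginDual (∀ j, G j),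
        Integrable (fun x => f x * (starRingEnd ℂ) (character γ x)) μ := by
      intro γ
      refine hf.mul_bdd (c := 1) ?_ (.of_forall fun x => ?_)
      · exact (Complex.continuous_conj.comp (continuous_character γ)).aestronglyMeasurable
      · rw [RCLike.norm_conj, norm_character]
    have h1 : ∀ x, f x * (starRingEnd ℂ) (g x) = ∑ γ ∈ T, (starRingEnd ℂ) (b γ * t γ) *
        (f x * (starRingEnd ℂ) (character γ x)) := by
      intro x
      simp only [hg, map_sum, Finset.mul_sum, map_mul]
      exact Finset.sum_congr rfl fun _ _ => by ring
    simp only [h1]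
    rw [integral_finsetSum _ fun γ _ => (hfi γ).const_mul _]
    simp only [integral_const_mul]
    have h2 : ∀ γ, (starRingEnd ℂ) (b γ * t γ) * fh γ = ((‖t γ * fh γ‖ ^ 2 / Q : ℝ) : ℂ) := by
      intro γ
      have h3 : ((‖t γ * fh γ‖ ^ 2 : ℝ) : ℂ) = t γ * fh γ * (starRingEnd ℂ) (t γ * fh γ) := by
        rw [Complex.mul_conj, Complex.normSq_eq_norm_sq]
      rw [Complex.ofReal_div, h3]
      simp only [hb, map_mul, map_div₀, Complex.conj_conj, Complex.conj_ofReal]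
      ring
    calc _ = ∑ γ ∈ T, ((‖t γ * fh γ‖ ^ 2 / Q : ℝ) : ℂ) := Finset.sum_congr rfl fun γ _ => h2 γ
      _ = _ := by
        rw [← Complex.ofReal_sum, ← Finset.sum_div, hQ2]
        congr 1
        field_simp
  set ψ : ℕ → ℝ → ℝ := fun k r => (δ * r ^ 2 / (8 * (k + 1)) ^ n) ^ (k + 1) with hψ
  have hψ0 : ∀ k r, 0 ≤ ψ k r := fun k r => by positivity
  have hψc : ∀ k, Continuous fun x => ψ k ‖g x‖ := fun k =>
    ((continuous_const.mul (hgc.norm.pow 2)).div_const _).pow _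
  have hψi : ∀ k, ∫⁻ x, ENNReal.ofReal (ψ k ‖g x‖) ∂μ ≤ ENNReal.ofReal ((1 / 2) ^ k) := by
    intro k
    rw [← ofReal_integral_eq_lintegral_ofReal (integrable_of_continuous (hψc k))
      (.of_forall fun x => hψ0 k _)]
    refine ENNReal.ofReal_le_ofReal ?_
    have h1 := integral_norm_sum_tensorWeight_pow_le μ hS hm (k := k + 1) (by simp) hT b
    rw [hb1, mul_one] at h1
    have h2 : ∀ x, ψ k ‖g x‖ = (δ / (8 * (k + 1)) ^ n) ^ (k + 1) * ‖g x‖ ^ (2 * (k + 1)) := by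
      intro x
      rw [pow_mul, ← mul_pow]
      simp only [hψ]
      congr 1
      ring
    simp only [h2]
    rw [integral_const_mul]
    push_cast at h1
    calc _ ≤ (δ / (8 * (k + 1)) ^ n) ^ (k + 1) *
          (P ^ (2 * (k + 1)) * ((8 * (k + 1 : ℝ)) ^ n) ^ (k + 1)) := by gcongr
      _ = (1 / 2) ^ (k + 1) := by
        rw [pow_mul, ← mul_pow, ← mul_pow]
        congr 1
        rw [hδ]
        field_simp
      _ ≤ (1 / 2) ^ k := pow_le_pow_of_le_one (by norm_num) (by norm_num) (Nat.le_succ k)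
  have hmeas : ∀ k, Measurable fun x => ENNReal.ofReal (ψ k ‖g x‖) :=
    fun k => (hψc k).measurable.ennreal_ofReal
  calc ENNReal.ofReal Q = ‖∫ x, f x * (starRingEnd ℂ) (g x) ∂μ‖ₑ := by
        rw [hpair, ← ofReal_norm, Complex.norm_real, Real.norm_of_nonneg hQ0.le]
    _ ≤ ∫⁻ x, ‖f x * (starRingEnd ℂ) (g x)‖ₑ ∂μ := enorm_integral_le_lintegral_enorm _
    _ ≤ ∫⁻ x, (ENNReal.ofReal A *
          ENNReal.ofReal (‖f x‖ * Real.log (1 + ‖f x‖) ^ ((n : ℝ) / 2)) + (ENNReal.ofReal B +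
          ENNReal.ofReal C * ∑' k, ENNReal.ofReal (ψ k ‖g x‖))) ∂μ := by
        refine lintegral_mono fun x => ?_
        -- The index `k` varies with `x`; bounding its term by the sum over all indices avoids any
        -- measurable selection.
        obtain ⟨k, hk⟩ := hyoung ‖f x‖ ‖g x‖ (norm_nonneg _) (norm_nonneg _)
        rw [← ofReal_norm, norm_mul, RCLike.norm_conj]
        have hlog : 0 ≤ ‖f x‖ * Real.log (1 + ‖f x‖) ^ ((n : ℝ) / 2) :=
          mul_nonneg (norm_nonneg _)
            (Real.rpow_nonneg (Real.log_nonneg (by linarith [norm_nonneg (f x)])) _)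
        calc _ ≤ _ := ENNReal.ofReal_le_ofReal hk
          _ = ENNReal.ofReal A *
              ENNReal.ofReal (‖f x‖ * Real.log (1 + ‖f x‖) ^ ((n : ℝ) / 2)) +
              (ENNReal.ofReal B + ENNReal.ofReal C * ENNReal.ofReal (ψ k ‖g x‖)) := by
            rw [add_assoc, ENNReal.ofReal_add (by positivity)
              (add_nonneg hB.le (mul_nonneg hC.le (hψ0 k _))),
              ENNReal.ofReal_add hB.le (mul_nonneg hC.le (hψ0 k _)), ENNReal.ofReal_mul hA.le,
              ENNReal.ofReal_mul hC.le]
          _ ≤ _ := by gcongr; exact ENNReal.le_tsum k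
    _ = ENNReal.ofReal A *
          ∫⁻ x, ENNReal.ofReal (‖f x‖ * Real.log (1 + ‖f x‖) ^ ((n : ℝ) / 2)) ∂μ +
          (ENNReal.ofReal B + ENNReal.ofReal C * ∑' k, ∫⁻ x, ENNReal.ofReal (ψ k ‖g x‖) ∂μ) := by
        have hm : Measurable fun x => ENNReal.ofReal B +
            ENNReal.ofReal C * ∑' k, ENNReal.ofReal (ψ k ‖g x‖) :=
          ((Measurable.tsum hmeas).const_mul _).const_add _
        rw [lintegral_add_right _ hm,
          lintegral_add_left measurable_const, lintegral_const_mul' _ _ ENNReal.ofReal_ne_top,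
          lintegral_const_mul' _ _ ENNReal.ofReal_ne_top,
          lintegral_tsum fun k => (hmeas k).aemeasurable]
        simp
    _ ≤ _ := by
        rw [ENNReal.ofReal_add hB.le (by positivity), ENNReal.ofReal_mul hC.le]
        gcongr
        calc _ ≤ ∑' k : ℕ, ENNReal.ofReal ((1 / 2) ^ k) := ENNReal.tsum_le_tsum hψi
          _ = _ := by
            rw [← ENNReal.ofReal_tsum_of_nonneg (fun k => by positivity) summable_geometric_two,
              tsum_geometric_two]

end Tensor

end SidonWeight

theorem proposition3p3 (n : ℕ) (G : Fin n → Type*) [∀ j, CommGroup (G j)]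
    [∀ j, TopologicalSpace (G j)] [∀ j, IsTopologicalGroup (G j)] [∀ j, CompactSpace (G j)]
    [∀ j, T2Space (G j)] (m : ∀ j, PontryaginDual (G j) → ℂ) (hm : ∀ j, IsSidonWeight (m j)) :
    (∃ A B : ℝ, 0 < A ∧ 0 < B ∧ ∀ f : (∀ j, G j) → ℂ,
      Integrable f (haarProb (∀ j, G j)) →
      (∑' γ : PontryaginDual (∀ j, G j),
          ‖tensorWeight m γ * fourierTransform f γ‖ₑ ^ 2) ^ (1 / 2 : ℝ)
        ≤ ENNReal.ofReal A * logIntegral ((n : ℝ≥0) / 2) f + ENNReal.ofReal B) ∧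
    IsMultiplierToL2 (LLog (∀ j, G j) ((n : ℝ≥0) / 2)) (tensorWeight m) := by
  classical
  choose S hS hSm using fun j => (hm j).exists_sum_le
  let : MeasurableSpace (∀ j, G j) := borel _
  have : BorelSpace (∀ j, G j) := ⟨rfl⟩
  have : IsProbabilityMeasure (haarProb (∀ j, G j)) := ⟨haarProb_univ _⟩
  have : (haarProb (∀ j, G j)).IsMulLeftInvariant :=
    inferInstanceAs (Measure.haarMeasure _).IsMulLeftInvariant
  obtain ⟨A, B, hA, hB, h⟩ := exists_ofReal_sqrt_sum_le (haarProb (∀ j, G j)) hS hSm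
  have hexp : (((n : ℝ≥0) / 2 : ℝ≥0) : ℝ) = (n : ℝ) / 2 := by push_cast; rfl
  have hsum : ∀ f : (∀ j, G j) → ℂ, Integrable f (haarProb (∀ j, G j)) →
      ∑' γ : PontryaginDual (∀ j, G j), ‖tensorWeight m γ * fourierTransform f γ‖ₑ ^ 2 ≤
        (ENNReal.ofReal A * logIntegral ((n : ℝ≥0) / 2) f + ENNReal.ofReal B) ^ 2 := by
    intro f hf
    rw [ENNReal.tsum_eq_iSup_sum]
    refine iSup_le fun T => ?_
    -- Characters outside the support of the weight contribute zero and are discarded, as the Sidon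
    -- inequality is available only on the support.
    have h1 := h f hf (T.filter fun γ => tensorWeight m γ ≠ 0)
      fun γ hγ => (Finset.mem_filter.1 hγ).2
    rw [logIntegral, hexp]
    refine le_trans (le_of_eq ?_) (pow_le_pow_left₀ zero_le h1 2)
    rw [← ENNReal.ofReal_pow (Real.sqrt_nonneg _), Real.sq_sqrt (by positivity),
      ENNReal.ofReal_sum_of_nonneg fun _ _ => by positivity]
    rw [Finset.sum_filter_of_ne]
    · refine Finset.sum_congr rfl fun γ _ => ?_
      rw [ENNReal.ofReal_pow (norm_nonneg _), ofReal_norm]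
      rfl
    · rintro γ _ hne h0
      simp [h0] at hne
  refine ⟨⟨A, B, hA, hB, fun f hf => ?_⟩, ?_, fun f hf => ?_⟩
  · refine (ENNReal.rpow_le_rpow (hsum f hf) (by norm_num)).trans_eq ?_
    rw [← ENNReal.rpow_natCast, ← ENNReal.rpow_mul]
    norm_num
  · have hbd : ∀ j χ, ‖m j χ‖ ≤ S j := by
      intro j χ
      by_cases h0 : m j χ = 0
      · rw [h0, norm_zero]; exact (hS j).le
      -- A single character has sup norm 1, so the Sidon inequality applied to it bounds the weight
      -- by `S j`.
      · simpa using hSm j {χ} 1 1 (by simpa using h0) (by simp [norm_character])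
    refine memℓp_infty ⟨∏ j, S j, ?_⟩
    rintro _ ⟨γ, rfl⟩
    simp only [tensorWeight, norm_prod]
    exact Finset.prod_le_prod (fun _ _ => norm_nonneg _) fun j _ => hbd j _
  · have hf' : logIntegral ((n : ℝ≥0) / 2) f < ∞ := hf
    have hlt := (hsum f (L1.integrable_coeFn f)).trans_lt (ENNReal.pow_lt_top (ENNReal.add_lt_top.2
      ⟨ENNReal.mul_lt_top ENNReal.ofReal_lt_top hf', ENNReal.ofReal_lt_top⟩))
    simpa using ENNReal.summable_toReal hlt.ne
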